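/- Let $p\neq 3$ be a prime, let $m,s$ be positive integers, and let $\mathcal R=\mathbb F_{p^m}[u,v]/\langle u^2,v^2,uv-vu\rangle=\mathbb F_{p^m}+u\mathbb F_{p^m}+v\mathbb F_{p^m}+uv\mathbb F_{p^m}$. Let $\alpha_1,\alpha_3,\alpha_4\in\mathbb F_{p^m}^*$ be such that $\alpha=\alpha_1+\alpha_3v+\alpha_4uv$ is not a cube in $\mathcal R$. Let $r_0$ be the remainder of $s$ on division by $m$ and put $\alpha_0=\alpha_1^{p^{m-r_0}}$ (so $\alpha_0^{p^s}=\alpha_1$). A linear $\alpha$-constacyclic code $\mathcal C$ of length $3p^s$ over $\mathcal R$ is an $\mathcal R$-submodule of $\mathcal R^{3p^s}$ closed under $(\zeta_0,\dots,\zeta_{3p^s-1})\mapsto(\alpha\zeta_{3p^s-1},\zeta_0,\dots,\zeta_{3p^s-2})$; it is identified with an ideal of $R=\mathcal R[x]/\langle x^{3p^s}-\alpha\rangle$ through $(\zeta_i)\mapsto\sum_i\zeta_ix^i$. Let $\bar R=(\mathbb F_{p^m}+v\mathbb F_{p^m})[x]/\langle x^{3p^s}-(\alpha_1+\alpha_3v)\rangle$,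 let $\psi_u:R\to\bar R$ be reduction modulo $u$, and put $\mathrm{Res}(\mathcal C)=\psi_u(\mathcal C)$ and $\mathrm{Tor}(\mathcal C)=\{a\in\bar R : ua\in\mathcal C\}$, where $ua$ means $ub$ for any $b\in R$ with $\psi_u(b)=a$ (this does not depend on $b$). Let $\eta_{\mathcal C}$ be the number of codewords of $\mathcal C$. Then the following hold. 1. (Type A) If $\mathcal C=\langle 0\rangle$, then $\mathrm{Res}(\mathcal C)=\mathrm{Tor}(\mathcal C)=\langle 0\rangle$ and $\eta_{\mathcal C}=1$. If $\mathcal C=\langle 1\rangle$, then $\mathrm{Res}(\mathcal C)=\mathrm{Tor}(\mathcal C)=\langle 1\rangle$ and $\eta_{\mathcal C}=p^{12mp^s}$. 2. (Type B) If $\mathcal C=\langle u(x^3-\alpha_0)^\ell\rangle$ with $0\le\ell\le 2p^s-1$, then $\mathrm{Res}(\mathcal C)=\langle 0\rangle$, $\mathrm{Tor}(\mathcal C)=\langle(x^3-\alpha_0)^\ell\rangle$ and $\eta_{\mathcal C}=p^{3m(2p^s-\ell)}$. 3. (Type C) (a) If $\mathcal C=\langle(x^3-\alpha_0)^\ell\rangle$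 with $1\le\ell\le 2p^s-1$, then $\mathrm{Res}(\mathcal C)=\langle(x^3-\alpha_0)^\ell\rangle$, $\mathrm{Tor}(\mathcal C)=\langle(x^3-\alpha_0)^{\Im}\rangle$, where the smallest integer $\Im\ge 0$ with $u(x^3-\alpha_0)^{\Im}\in\mathcal C$ is $\Im=\ell$, and $\eta_{\mathcal C}=p^{6m(2p^s-\ell)}$. (b) If $\mathcal C=\langle(x^3-\alpha_0)^\ell+u(x^3-\alpha_0)^tz(x)\rangle$ with $1\le\ell\le 2p^s-1$, $0\le t<\ell$ and $z(x)\in R$ invertible, then $\mathrm{Res}(\mathcal C)=\langle(x^3-\alpha_0)^\ell\rangle$ and $\mathrm{Tor}(\mathcal C)=\langle(x^3-\alpha_0)^{\Im}\rangle$, where the smallest integer $\Im\ge 0$ with $u(x^3-\alpha_0)^{\Im}\in\mathcal C$ is $\Im=\min\{\ell,2p^s+t-\ell\}$. Moreover $\eta_{\mathcal C}=p^{6m(2p^s-\ell)}$ if $1\le\ell\le p^s+\frac t2$, and $\eta_{\mathcal C}=p^{3m(2p^s-t)}$ if $p^s+\frac t2<\ell\le 2p^s-1$. 4. (Type D) If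 $\mathcal C=\langle(x^3-\alpha_0)^\ell+u(x^3-\alpha_0)^tz(x),\,u(x^3-\alpha_0)^\mu\rangle$ with $1\le\ell\le 2p^s-1$, $0\le t<\ell$, $\mu\ge 0$, and either $z(x)=0$ and $\mu<\ell$, or $z(x)\in R$ invertible and $\mu<\min\{\ell,2p^s+t-\ell\}$, then $\mathrm{Res}(\mathcal C)=\langle(x^3-\alpha_0)^\ell\rangle$, $\mathrm{Tor}(\mathcal C)=\langle(x^3-\alpha_0)^\mu\rangle$ and $\eta_{\mathcal C}=p^{3m(4p^s-\ell-\mu)}$. -/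

import Mathlib

namespace Constacyclic

section Codes

variable {A : Type*} [CommRing A]

/-- The `α`-constacyclic shift `(ζ₀, …, ζₙ₋₁) ↦ (α ζₙ₋₁, ζ₀, …, ζₙ₋₂)` on `Aⁿ`. -/
def shift {n : ℕ} (α : A) (ζ : Fin n → A) : Fin n → A := fun i =>
  if (i : ℕ) = 0 then α * ζ ⟨n - 1, Nat.sub_lt (Nat.lt_of_le_of_lt (Nat.zero_le _) i.isLt) Nat.one_pos⟩
  else ζ ⟨(i : ℕ) - 1, Nat.lt_of_le_of_lt (Nat.sub_le _ _) i.isLt⟩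

/-- The polynomial `xⁿ - α`. -/
noncomputable def modulus (n : ℕ) (α : A) : Polynomial A :=
  Polynomial.X ^ n - Polynomial.C α

/-- The ambient ring `A[x] / ⟨xⁿ - α⟩`. -/
abbrev Ambient (n : ℕ) (α : A) : Type _ := AdjoinRoot (modulus n α)

/-- A linear `α`-constacyclic code of length `n` over `A`: an `A`-submodule of `Aⁿ`
that is closed under the `α`-constacyclic shift. -/
structure Code (A : Type*) [CommRing A] (n : ℕ) (α : A) where
  words : Submodule A (Fin n → A)
  shift_mem : ∀ ζ ∈ words, shift α ζ ∈ words

/-- The identification of the word `(ζ₀, …, ζₙ₋₁)` with the class of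
`ζ₀ + ζ₁ x + ⋯ + ζₙ₋₁ xⁿ⁻¹` in `A[x] / ⟨xⁿ - α⟩`. -/
noncomputable def wordClass (n : ℕ) (α : A) (ζ : Fin n → A) : Ambient n α :=
  ∑ i : Fin n, AdjoinRoot.of (modulus n α) (ζ i) * AdjoinRoot.root (modulus n α) ^ (i : ℕ)

theorem root_pow (n : ℕ) (α : A) :
    AdjoinRoot.root (modulus n α) ^ n = AdjoinRoot.of (modulus n α) α := by
  have h : AdjoinRoot.mk (modulus n α) (Polynomial.X ^ n - Polynomial.C α) = 0 :=
    AdjoinRoot.mk_self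
  rw [map_sub, map_pow, AdjoinRoot.mk_X, AdjoinRoot.mk_C] at h
  exact sub_eq_zero.mp h

theorem wordClass_add (n : ℕ) (α : A) (ζ ξ : Fin n → A) :
    wordClass n α (ζ + ξ) = wordClass n α ζ + wordClass n α ξ := by
  simp [wordClass, add_mul, Finset.sum_add_distrib]

theorem wordClass_smul (n : ℕ) (α a : A) (ζ : Fin n → A) :
    wordClass n α (a • ζ) = AdjoinRoot.of (modulus n α) a * wordClass n α ζ := by
  simp [wordClass, Finset.mul_sum, mul_assoc]

theorem wordClass_shift (n : ℕ) (α : A) (ζ : Fin n → A) :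
    wordClass n α (shift α ζ) = AdjoinRoot.root (modulus n α) * wordClass n α ζ := by
  cases n with
  | zero => simp [wordClass]
  | succ k =>
    have h := root_pow (k + 1) α
    unfold wordClass
    rw [Fin.sum_univ_succ, Fin.sum_univ_castSucc (n := k)]
    have h1 : ∀ i : Fin k, shift α ζ i.succ = ζ i.castSucc := by
      intro i
      simp only [shift, Fin.val_succ, Nat.succ_ne_zero, if_false]
      rfl
    have h0 : shift α ζ 0 = α * ζ (Fin.last k) := by
      simp only [shift, Fin.val_zero, if_true]
      rfl
    simp only [h1, h0, Fin.val_succ, Fin.val_castSucc, Fin.val_last, Fin.val_zero, pow_zero,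
      mul_one, map_mul, ← h]
    rw [mul_add, Finset.mul_sum]
    refine (add_comm _ _).trans ?_
    refine congrArg₂ (· + ·) (Finset.sum_congr rfl fun i _ => ?_) ?_
    · rw [pow_succ]; ac_rfl
    · rw [pow_succ]; ac_rfl

/-- The ideal of `A[x] / ⟨xⁿ - α⟩` that a constacyclic code is identified with: the set of the
classes of its codewords. -/
noncomputable def Code.toIdeal {n : ℕ} {α : A} (K : Code A n α) : Ideal (Ambient n α) where
  carrier := {f | ∃ ζ ∈ K.words, wordClass n α ζ = f}
  zero_mem' := ⟨0, K.words.zero_mem, by simp [wordClass]⟩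
  add_mem' := by
    rintro _ _ ⟨ζ, hζ, rfl⟩ ⟨ξ, hξ, rfl⟩
    exact ⟨ζ + ξ, K.words.add_mem hζ hξ, wordClass_add n α ζ ξ⟩
  smul_mem' := by
    intro c f hf
    obtain ⟨q, rfl⟩ := AdjoinRoot.mk_surjective c
    induction q using Polynomial.induction_on with
    | C a =>
      obtain ⟨ζ, hζ, rfl⟩ := hf
      exact ⟨a • ζ, K.words.smul_mem a hζ, by
        rw [wordClass_smul, AdjoinRoot.mk_C, smul_eq_mul]⟩
    | add q r hq hr =>
      obtain ⟨ζ, hζ, h1⟩ := hq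
      obtain ⟨ξ, hξ, h2⟩ := hr
      exact ⟨ζ + ξ, K.words.add_mem hζ hξ, by rw [wordClass_add, h1, h2, map_add, add_smul]⟩
    | monomial k a ih =>
      obtain ⟨ζ, hζ, h1⟩ := ih
      refine ⟨shift α ζ, K.shift_mem ζ hζ, ?_⟩
      rw [wordClass_shift, h1]
      simp only [map_mul, map_pow, AdjoinRoot.mk_X, AdjoinRoot.mk_C, smul_eq_mul]
      ring

/-- The number of codewords. -/
noncomputable def Code.numWords {n : ℕ} {α : A} (K : Code A n α) : ℕ := Nat.card K.words

end Codes

section Ring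

variable (F : Type*) [Field F]

/-- The ring `F + vF` with `v² = 0`. -/
abbrev BaseRing : Type _ := DualNumber F

/-- The ring `F + uF + vF + uvF = F[u, v] / ⟨u², v², uv - vu⟩`, realised as
`(F + vF) + u(F + vF)` with `u² = 0`. -/
abbrev CoeffRing : Type _ := DualNumber (BaseRing F)

/-- The element `v` of `F + vF`. -/
def vBase : BaseRing F := DualNumber.eps

/-- The element `v` of `F + uF + vF + uvF`. -/
def v : CoeffRing F := TrivSqZeroExt.inl (vBase F)

/-- The element `u` of `F + uF + vF + uvF`. -/
def u : CoeffRing F := DualNumber.eps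

variable {F}

/-- The element `α₁ + α₃ v + α₄ uv`. -/
def unitElt (α₁ α₃ α₄ : F) : CoeffRing F :=
  algebraMap F (CoeffRing F) α₁ + algebraMap F (CoeffRing F) α₃ * v F
    + algebraMap F (CoeffRing F) α₄ * (u F * v F)

/-- The element `α₁ + α₃ v` of `F + vF`. -/
def unitBase (α₁ α₃ : F) : BaseRing F :=
  algebraMap F (BaseRing F) α₁ + algebraMap F (BaseRing F) α₃ * vBase F

/-- Reduction modulo `u` on coefficients, `F + uF + vF + uvF → F + vF`. -/
def redCoeff (F : Type*) [Field F] : CoeffRing F →+* BaseRing F :=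
  (TrivSqZeroExt.fstHom F (BaseRing F) (BaseRing F)).toRingHom

theorem redCoeff_unitElt (α₁ α₃ α₄ : F) :
    redCoeff F (unitElt α₁ α₃ α₄) = unitBase α₁ α₃ := by
  change TrivSqZeroExt.fst (unitElt α₁ α₃ α₄) = unitBase α₁ α₃
  simp only [unitElt, unitBase, u, v, TrivSqZeroExt.fst_add, TrivSqZeroExt.fst_mul,
    TrivSqZeroExt.fst_inl, DualNumber.fst_eps, zero_mul, mul_zero, add_zero]
  rfl

theorem map_modulus (n : ℕ) (α₁ α₃ α₄ : F) :
    (modulus n (unitElt α₁ α₃ α₄)).map (redCoeff F) = modulus n (unitBase α₁ α₃) := by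
  simp [modulus, redCoeff_unitElt]

/-- Reduction modulo `u`, the ring homomorphism
`(F + uF + vF + uvF)[x]/⟨xⁿ - (α₁ + α₃v + α₄uv)⟩ → (F + vF)[x]/⟨xⁿ - (α₁ + α₃v)⟩`
that reduces coefficients and sends `x` to `x`. -/
noncomputable def psi (n : ℕ) (α₁ α₃ α₄ : F) :
    Ambient n (unitElt α₁ α₃ α₄) →+* Ambient n (unitBase α₁ α₃) :=
  AdjoinRoot.map (redCoeff F) _ _ (map_modulus n α₁ α₃ α₄).symm.dvd

theorem psi_mk (n : ℕ) (α₁ α₃ α₄ : F) (q : Polynomial (CoeffRing F)) :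
    psi n α₁ α₃ α₄ (AdjoinRoot.mk _ q) = AdjoinRoot.mk _ (q.map (redCoeff F)) := by
  induction q using Polynomial.induction_on' with
  | add q r hq hr => rw [map_add, map_add, hq, hr, Polynomial.map_add, map_add]
  | monomial k a =>
    rw [← Polynomial.C_mul_X_pow_eq_monomial]
    simp [psi]

theorem exists_map_redCoeff (q : Polynomial (BaseRing F)) :
    ∃ r : Polynomial (CoeffRing F), r.map (redCoeff F) = q :=
  Polynomial.map_surjective (redCoeff F) (fun a => ⟨TrivSqZeroExt.inl a, rfl⟩) q

theorem psi_surjective (n : ℕ) (α₁ α₃ α₄ : F) : Function.Surjective (psi n α₁ α₃ α₄) := by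
  intro y
  obtain ⟨q, rfl⟩ := AdjoinRoot.mk_surjective y
  obtain ⟨r, rfl⟩ := exists_map_redCoeff q
  exact ⟨AdjoinRoot.mk _ r, psi_mk n α₁ α₃ α₄ r⟩

/-- The class of `u` in the ambient ring. -/
noncomputable def uClass (n : ℕ) (α₁ α₃ α₄ : F) : Ambient n (unitElt α₁ α₃ α₄) :=
  AdjoinRoot.of _ (u F)

/-- The residue `Res(I) = ψᵤ(I)` of an ideal. -/
noncomputable def Res {n : ℕ} {α₁ α₃ α₄ : F} (I : Ideal (Ambient n (unitElt α₁ α₃ α₄))) :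
    Ideal (Ambient n (unitBase α₁ α₃)) where
  carrier := psi n α₁ α₃ α₄ '' I
  zero_mem' := ⟨0, I.zero_mem, map_zero _⟩
  add_mem' := by
    rintro _ _ ⟨a, ha, rfl⟩ ⟨b, hb, rfl⟩
    exact ⟨a + b, I.add_mem ha hb, map_add _ _ _⟩
  smul_mem' := by
    rintro c _ ⟨a, ha, rfl⟩
    obtain ⟨d, rfl⟩ := psi_surjective n α₁ α₃ α₄ c
    exact ⟨d * a, I.mul_mem_left d ha, map_mul _ _ _⟩

/-- The torsion `Tor(I) = {a : u a ∈ I}` of an ideal; here `a` lies in the ambient ring over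
`F + vF`, and `u a` means `u b` for any `b` that reduces to `a` modulo `u`
(the choice of `b` does not matter, see `psi_mem_Tor`). -/
noncomputable def Tor {n : ℕ} {α₁ α₃ α₄ : F} (I : Ideal (Ambient n (unitElt α₁ α₃ α₄))) :
    Ideal (Ambient n (unitBase α₁ α₃)) where
  carrier := {a | ∃ b, psi n α₁ α₃ α₄ b = a ∧ uClass n α₁ α₃ α₄ * b ∈ I}
  zero_mem' := ⟨0, map_zero _, by simp⟩
  add_mem' := by
    rintro _ _ ⟨a, rfl, ha⟩ ⟨b, rfl, hb⟩
    exact ⟨a + b, map_add _ _ _, by rw [mul_add]; exact I.add_mem ha hb⟩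
  smul_mem' := by
    rintro c _ ⟨a, rfl, ha⟩
    obtain ⟨d, rfl⟩ := psi_surjective n α₁ α₃ α₄ c
    exact ⟨d * a, map_mul _ _ _, by rw [mul_left_comm]; exact I.mul_mem_left d ha⟩

theorem uClass_mul_eq_zero {n : ℕ} {α₁ α₃ α₄ : F} {b : Ambient n (unitElt α₁ α₃ α₄)}
    (hb : psi n α₁ α₃ α₄ b = 0) : uClass n α₁ α₃ α₄ * b = 0 := by
  obtain ⟨q, rfl⟩ := AdjoinRoot.mk_surjective b
  rw [psi_mk, AdjoinRoot.mk_eq_zero] at hb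
  obtain ⟨g, hg⟩ := hb
  obtain ⟨r, rfl⟩ := exists_map_redCoeff g
  rw [← map_modulus n α₁ α₃ α₄, ← Polynomial.map_mul] at hg
  have key : Polynomial.C (u F) * (q - modulus n (unitElt α₁ α₃ α₄) * r) = 0 := by
    ext1 k
    have hk := congrArg (fun t => Polynomial.coeff t k) hg
    simp only [Polynomial.coeff_map] at hk
    have hk' : TrivSqZeroExt.fst ((q - modulus n (unitElt α₁ α₃ α₄) * r).coeff k) = 0 := by
      rw [Polynomial.coeff_sub, TrivSqZeroExt.fst_sub]
      exact sub_eq_zero.mpr hk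
    rw [Polynomial.coeff_C_mul, Polynomial.coeff_zero]
    refine TrivSqZeroExt.ext ?_ ?_
    · rw [TrivSqZeroExt.fst_mul, hk', mul_zero]; rfl
    · rw [DualNumber.snd_mul, hk', u, DualNumber.fst_eps]; simp
  have h2 := congrArg (AdjoinRoot.mk (modulus n (unitElt α₁ α₃ α₄))) key
  rw [map_mul, map_sub, map_mul, AdjoinRoot.mk_self, zero_mul, sub_zero, map_zero,
    AdjoinRoot.mk_C] at h2
  exact h2

theorem psi_mem_Tor {n : ℕ} {α₁ α₃ α₄ : F} (I : Ideal (Ambient n (unitElt α₁ α₃ α₄)))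
    (b : Ambient n (unitElt α₁ α₃ α₄)) :
    psi n α₁ α₃ α₄ b ∈ Tor I ↔ uClass n α₁ α₃ α₄ * b ∈ I := by
  refine ⟨?_, fun h => ⟨b, rfl, h⟩⟩
  rintro ⟨c, hc, h⟩
  have h0 : psi n α₁ α₃ α₄ (b - c) = 0 := by rw [map_sub, hc, sub_self]
  have h1 := uClass_mul_eq_zero h0
  rw [mul_sub, sub_eq_zero] at h1
  rwa [h1]

/-- For `s = q₀ m + r₀` with `0 ≤ r₀ < m`, the element `α₀ = α₁ ^ (p ^ (m - r₀))`, so that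
`α₀ ^ (p ^ s) = α₁` in a field with `p ^ m` elements. -/
def alphaZero (p m s : ℕ) (α₁ : F) : F := α₁ ^ p ^ (m - s % m)

/-- The class of `x³ - a` in the ambient ring `A[x] / ⟨xⁿ - α⟩` over an `F`-algebra `A`. -/
noncomputable def cubic {A : Type*} [CommRing A] [Algebra F A] (n : ℕ) (α : A) (a : F) :
    Ambient n α :=
  AdjoinRoot.root (modulus n α) ^ 3 - AdjoinRoot.of (modulus n α) (algebraMap F A a)

end Ring

end Constacyclic

/-! Write f = x³ - α₀ over F. Frobenius gives f^(p^s) = x^(3p^s) - α₁, which becomes α₃v in the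
ambient ring over F + vF and v(α₃ + α₄u) over the full coefficient ring. Both square to zero, so the
class w of f satisfies w^(2p^s) = 0. Since α₃ is invertible, v is a polynomial in x over F + vF;
hence F[x] maps onto that ambient ring, and counting identifies it with F[x]/⟨f^(2p^s)⟩
(`evalRoot_eq_zero_iff`). Orders and annihilators of powers of f are then read off from divisibility
in F[x].

Multiplication by u identifies the ambient ring modulo u with the kernel of reduction, so |I| = |Res
I| · |Tor I| (`card_eq_card_Res_mul_card_Tor`).

Every type is an ideal ⟨w^l + u w^t z, u w^μ⟩. Its residue is immediate, its torsion is
`Tor_span_pair`, and `span_singleton_eq_span_pair` supplies the second generator for Type C.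
Exponents 0 and 2p^s cover Types A and B. -/

namespace Constacyclic

/-! ### Codewords and elements of the ambient ring -/

section Words

variable {A : Type*} [CommRing A]

theorem modulus_monic {n : ℕ} (hn : n ≠ 0) (α : A) : (modulus n α).Monic :=
  Polynomial.monic_X_pow_sub_C α hn

theorem natDegree_modulus [Nontrivial A] (n : ℕ) (α : A) :
    (modulus n α).natDegree = n :=
  Polynomial.natDegree_X_pow_sub_C

/-- The modulus is monic of degree n, so the powers of x below n form a basis. -/
theorem wordClass_bijective [Nontrivial A] {n : ℕ} (hn : n ≠ 0) (α : A) :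
    Function.Bijective (wordClass n α) := by
  let b := (AdjoinRoot.powerBasis' (modulus_monic hn α)).basis.reindex
    (finCongr (natDegree_modulus n α))
  have hb : ∀ ζ, wordClass n α ζ = b.equivFun.symm ζ := by
    intro ζ
    rw [Module.Basis.equivFun_symm_apply]
    refine Finset.sum_congr rfl fun i _ => ?_
    simp [b, Algebra.smul_def]
    rfl
  rw [funext hb]
  exact b.equivFun.symm.bijective

theorem card_ambient [Nontrivial A] {n : ℕ} (hn : n ≠ 0) (α : A) :
    Nat.card (Ambient n α) = Nat.card A ^ n := by
  rw [← Nat.card_congr (Equiv.ofBijective _ (wordClass_bijective hn α)), Nat.card_fun,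
    Nat.card_fin]

theorem Code.numWords_eq_card [Nontrivial A] {n : ℕ} (hn : n ≠ 0) {α : A} (K : Code A n α) :
    K.numWords = Nat.card K.toIdeal := by
  have h : (K.toIdeal : Set (Ambient n α)) = wordClass n α '' (K.words : Set (Fin n → A)) := rfl
  refine Eq.symm ((Nat.card_congr (Equiv.setCongr h)).trans ?_)
  exact Nat.card_image_of_injective (wordClass_bijective hn α).injective _

end Words

/-! ### Reduction modulo u: kernel, torsion and counting -/

section Reduction

variable {F : Type*} [Field F]

theorem exists_C_u_mul {P : Polynomial (CoeffRing F)} (hP : P.map (redCoeff F) = 0) :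
    ∃ h : Polynomial (CoeffRing F), P = Polynomial.C (u F) * h := by
  obtain ⟨h, hh⟩ : Polynomial.C (u F) ∣ P := by
    rw [Polynomial.C_dvd_iff_dvd_coeff]
    intro i
    have hi : TrivSqZeroExt.fst (P.coeff i) = 0 := by
      have := congrArg (fun t => Polynomial.coeff t i) hP
      simp only [Polynomial.coeff_map, Polynomial.coeff_zero] at this
      exact this
    refine ⟨TrivSqZeroExt.inl (TrivSqZeroExt.snd (P.coeff i)), ?_⟩
    refine TrivSqZeroExt.ext ?_ ?_
    · rw [TrivSqZeroExt.fst_mul, hi, u, DualNumber.fst_eps, zero_mul]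
    · simp [u]
  exact ⟨h, hh⟩

theorem map_redCoeff_eq_zero {P : Polynomial (CoeffRing F)} (hP : Polynomial.C (u F) * P = 0) :
    P.map (redCoeff F) = 0 := by
  ext1 i
  have := congrArg (fun t => TrivSqZeroExt.snd (Polynomial.coeff t i)) hP
  simp only [Polynomial.coeff_C_mul, Polynomial.coeff_zero] at this
  rw [DualNumber.snd_mul] at this
  simp only [u, DualNumber.fst_eps, DualNumber.snd_eps, zero_mul, one_mul, zero_add] at this
  rw [Polynomial.coeff_map, Polynomial.coeff_zero]
  exact this

variable {n : ℕ} {α₁ α₃ α₄ : F}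

theorem psi_uClass : psi n α₁ α₃ α₄ (uClass n α₁ α₃ α₄) = 0 := by
  have h : redCoeff F (u F) = 0 := DualNumber.fst_eps
  rw [uClass, ← AdjoinRoot.mk_C, psi_mk, Polynomial.map_C, h, map_zero, map_zero]

theorem uClass_mul_self : uClass n α₁ α₃ α₄ * uClass n α₁ α₃ α₄ = 0 :=
  uClass_mul_eq_zero psi_uClass

theorem exists_uClass_mul {b : Ambient n (unitElt α₁ α₃ α₄)} (hb : psi n α₁ α₃ α₄ b = 0) :
    ∃ c, b = uClass n α₁ α₃ α₄ * c := by
  obtain ⟨q, rfl⟩ := AdjoinRoot.mk_surjective b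
  rw [psi_mk, AdjoinRoot.mk_eq_zero] at hb
  obtain ⟨g, hg⟩ := hb
  obtain ⟨r, rfl⟩ := exists_map_redCoeff g
  rw [← map_modulus n α₁ α₃ α₄, ← Polynomial.map_mul, ← sub_eq_zero, ← Polynomial.map_sub] at hg
  obtain ⟨h, hh⟩ := exists_C_u_mul hg
  refine ⟨AdjoinRoot.mk _ h, ?_⟩
  have := congrArg (AdjoinRoot.mk (modulus n (unitElt α₁ α₃ α₄))) hh
  rwa [map_sub, map_mul, AdjoinRoot.mk_self, zero_mul, sub_zero, map_mul, AdjoinRoot.mk_C] at this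

/-- Converse of `uClass_mul_eq_zero`: the annihilator of u is no larger than the kernel of
reduction. A monic modulus stays a non-zero-divisor after reduction, so in uq = (xⁿ - α)g the factor
g is itself a multiple of u, and u can be taken out of the whole relation. -/
theorem psi_eq_zero_of_uClass_mul (hn : n ≠ 0) {b : Ambient n (unitElt α₁ α₃ α₄)}
    (hb : uClass n α₁ α₃ α₄ * b = 0) : psi n α₁ α₃ α₄ b = 0 := by
  obtain ⟨q, rfl⟩ := AdjoinRoot.mk_surjective b
  rw [uClass, ← AdjoinRoot.mk_C, ← map_mul, AdjoinRoot.mk_eq_zero] at hb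
  obtain ⟨g, hg⟩ := hb
  have hu : redCoeff F (u F) = 0 := DualNumber.fst_eps
  have hg0 : g.map (redCoeff F) = 0 := by
    have := congrArg (Polynomial.map (redCoeff F)) hg
    rw [Polynomial.map_mul, Polynomial.map_mul, map_modulus, Polynomial.map_C, hu, map_zero,
      zero_mul] at this
    exact (modulus_monic hn (unitBase α₁ α₃)).mul_right_eq_zero_iff.mp this.symm
  obtain ⟨h, rfl⟩ := exists_C_u_mul hg0
  rw [mul_left_comm, ← sub_eq_zero, ← mul_sub] at hg
  have h0 := map_redCoeff_eq_zero hg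
  rw [Polynomial.map_sub, Polynomial.map_mul, map_modulus, sub_eq_zero] at h0
  rw [psi_mk, h0, map_mul, AdjoinRoot.mk_self, zero_mul]

/-- Reduction maps I onto Res I, and a ↦ ua is a bijection from Tor I to the kernel of that map. -/
theorem card_eq_card_Res_mul_card_Tor (hn : n ≠ 0) (I : Ideal (Ambient n (unitElt α₁ α₃ α₄))) :
    Nat.card I = Nat.card (Res I) * Nat.card (Tor I) := by
  let φ : I →+ Ambient n (unitBase α₁ α₃) :=
    (psi n α₁ α₃ α₄).toAddMonoidHom.comp I.toAddSubgroup.subtype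
  have hrange : Nat.card φ.range = Nat.card (Res I) := by
    refine Nat.card_congr (Equiv.setCongr ?_)
    ext x
    constructor
    · rintro ⟨a, rfl⟩
      exact ⟨a, a.2, rfl⟩
    · rintro ⟨a, ha, rfl⟩
      exact ⟨⟨a, ha⟩, rfl⟩
  have hker : Nat.card (Tor I) = Nat.card φ.ker := by
    -- A set-theoretic section of reduction suffices: u · r(a) does not depend on the chosen lift.
    choose r hr using psi_surjective n α₁ α₃ α₄
    have hmem : ∀ a : Tor I, uClass n α₁ α₃ α₄ * r a ∈ I := fun a =>
      (psi_mem_Tor I _).mp ((hr a).symm ▸ a.2)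
    have hk : ∀ a : Tor I, φ ⟨_, hmem a⟩ = 0 := fun a => by
      change psi n α₁ α₃ α₄ (uClass n α₁ α₃ α₄ * r a) = 0
      rw [map_mul, psi_uClass, zero_mul]
    refine Nat.card_eq_of_bijective (fun a : Tor I => (⟨⟨_, hmem a⟩, hk a⟩ : φ.ker)) ⟨?_, ?_⟩
    · intro a b hab
      have h : uClass n α₁ α₃ α₄ * r a = uClass n α₁ α₃ α₄ * r b :=
        congrArg (fun x : φ.ker => ((x : I) : Ambient n (unitElt α₁ α₃ α₄))) hab
      rw [← sub_eq_zero, ← mul_sub] at h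
      have h0 := psi_eq_zero_of_uClass_mul hn h
      rw [map_sub, hr, hr, sub_eq_zero] at h0
      exact Subtype.ext h0
    · rintro ⟨⟨b, hb⟩, hb0⟩
      obtain ⟨c, rfl⟩ := exists_uClass_mul (b := b) hb0
      refine ⟨⟨psi n α₁ α₃ α₄ c, (psi_mem_Tor I c).mpr hb⟩, Subtype.ext (Subtype.ext ?_)⟩
      change uClass n α₁ α₃ α₄ * r _ = uClass n α₁ α₃ α₄ * c
      rw [← sub_eq_zero, ← mul_sub]
      exact uClass_mul_eq_zero (by rw [map_sub, hr, sub_self])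
  rw [hker, ← hrange, AddSubgroup.card_eq_card_quotient_mul_card_addSubgroup φ.ker,
    Nat.card_congr (QuotientAddGroup.quotientKerEquivRange φ).toEquiv]

theorem Res_span (S : Set (Ambient n (unitElt α₁ α₃ α₄))) :
    Res (Ideal.span S) = Ideal.span (psi n α₁ α₃ α₄ '' S) := by
  rw [← Ideal.map_span]
  ext x
  exact (Ideal.mem_map_iff_of_surjective _ (psi_surjective n α₁ α₃ α₄)).symm

end Reduction

/-! ### Powers of x³ - α₀ in the ambient rings -/

section Base

open Polynomial

variable {F : Type*} [Field F]

/-- The homomorphism `F[x] → A[x] / ⟨xⁿ - α⟩` that sends `x` to `x`. -/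
noncomputable def evalRoot {A : Type*} [CommRing A] [Algebra F A] (n : ℕ) (α : A) :
    F[X] →+* Ambient n α :=
  eval₂RingHom ((AdjoinRoot.of (modulus n α)).comp (algebraMap F A)) (AdjoinRoot.root _)

theorem evalRoot_cubic {A : Type*} [CommRing A] [Algebra F A] (n : ℕ) (α : A) (a : F) :
    evalRoot n α (X ^ 3 - C a) = cubic n α a := by
  simp [evalRoot, cubic]

/-- The total exponent of p is m - r₀ + s, a multiple of m, and the p^m-th power map is the identity
on F. -/
theorem alphaZero_pow [Fintype F] {p m s : ℕ} (hm : 0 < m) (hF : Fintype.card F = p ^ m)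
    (α₁ : F) : alphaZero p m s α₁ ^ p ^ s = α₁ := by
  have h : m - s % m + s = m * (s / m + 1) := by
    have := Nat.mod_lt s hm
    have := Nat.div_add_mod s m
    rw [mul_add]
    omega
  rw [alphaZero, ← pow_mul, ← pow_add, h, pow_mul, ← hF, FiniteField.pow_card_pow]

/-- Frobenius is applied in F[x], where the characteristic is p; the result is then evaluated at x,
with x^(3p^s) = α. -/
theorem cubic_pow [Fintype F] {p m s : ℕ} (hp : p.Prime) (hm : 0 < m)
    (hF : Fintype.card F = p ^ m) (α₁ : F) {A : Type*} [CommRing A] [Algebra F A] (α : A) :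
    cubic (3 * p ^ s) α (alphaZero p m s α₁) ^ p ^ s =
      AdjoinRoot.of _ (α - algebraMap F A α₁) := by
  have := Fact.mk hp
  have : CharP F p := charP_of_card_eq_prime_pow (f := m) hF
  rw [← evalRoot_cubic, ← map_pow, sub_pow_char_pow, ← pow_mul, ← C_pow,
    alphaZero_pow hm hF, map_sub, map_pow, map_sub]
  simp [evalRoot, root_pow]

theorem unitElt_sub (α₁ α₃ α₄ : F) :
    unitElt α₁ α₃ α₄ - algebraMap F _ α₁ =
      v F * (algebraMap F _ α₃ + algebraMap F _ α₄ * u F) := by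
  rw [unitElt]; ring

theorem unitBase_sub (α₁ α₃ : F) :
    unitBase α₁ α₃ - algebraMap F _ α₁ = algebraMap F _ α₃ * vBase F := by
  rw [unitBase]; ring

theorem unitElt_sub_sq (α₁ α₃ α₄ : F) : (unitElt α₁ α₃ α₄ - algebraMap F _ α₁) ^ 2 = 0 := by
  have h : v F * v F = 0 := by
    rw [v, ← TrivSqZeroExt.inl_mul, vBase, DualNumber.eps_mul_eps, TrivSqZeroExt.inl_zero]
  rw [unitElt_sub]
  linear_combination (algebraMap F _ α₃ + algebraMap F _ α₄ * u F) ^ 2 * h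

theorem unitBase_sub_sq (α₁ α₃ : F) : (unitBase α₁ α₃ - algebraMap F _ α₁) ^ 2 = 0 := by
  have h : vBase F * vBase F = 0 := DualNumber.eps_mul_eps
  rw [unitBase_sub]
  linear_combination (algebraMap F _ α₃) ^ 2 * h

theorem cubic_pow_two_mul [Fintype F] {p m s : ℕ} (hp : p.Prime) (hm : 0 < m)
    (hF : Fintype.card F = p ^ m) {α₁ : F} {A : Type*} [CommRing A] [Algebra F A] {α : A}
    (h : (α - algebraMap F A α₁) ^ 2 = 0) :
    cubic (3 * p ^ s) α (alphaZero p m s α₁) ^ (2 * p ^ s) = 0 := by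
  rw [mul_comm 2, pow_mul, cubic_pow hp hm hF, ← map_pow, h, map_zero]

theorem baseRing_eq (a : BaseRing F) :
    a = algebraMap F _ a.fst + algebraMap F _ a.snd * vBase F := by
  refine TrivSqZeroExt.ext ?_ ?_
  · simp [vBase, TrivSqZeroExt.algebraMap_eq_inl]
  · simp [vBase, TrivSqZeroExt.algebraMap_eq_inl]

theorem evalRoot_C {A : Type*} [CommRing A] [Algebra F A] (n : ℕ) (α : A) (a : F) :
    evalRoot n α (C a) = AdjoinRoot.of _ (algebraMap F A a) := by
  simp [evalRoot]

theorem evalRoot_X {A : Type*} [CommRing A] [Algebra F A] (n : ℕ) (α : A) :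
    evalRoot (F := F) n α X = AdjoinRoot.root _ := by
  simp [evalRoot]

theorem card_quotient_span_monic {K : Type*} [Field K] {g : K[X]} (hg : g.Monic) :
    Nat.card (K[X] ⧸ Ideal.span {g}) = Nat.card K ^ g.natDegree := by
  have h := Nat.card_congr (AdjoinRoot.powerBasis' hg).basis.equivFun.toEquiv
  rw [Nat.card_fun, Nat.card_fin] at h
  exact h

theorem monic_cubic_pow (a : F) (l : ℕ) : ((X ^ 3 - C a) ^ l : F[X]).Monic :=
  (monic_X_pow_sub_C a three_ne_zero).pow l

theorem natDegree_cubic_pow (a : F) (l : ℕ) : ((X ^ 3 - C a) ^ l : F[X]).natDegree = 3 * l := by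
  rw [natDegree_pow, natDegree_X_pow_sub_C, mul_comm]

/-! ### The ambient ring over F + vF as a quotient of F[x] -/

section ChainRing

variable {p m s : ℕ} {α₁ α₃ : F}

/-- The image contains F and x, and also v, since f^(p^s) evaluates to α₃v with α₃ ≠ 0. -/
theorem evalRoot_surjective [Fintype F] (hp : p.Prime) (hm : 0 < m) (hF : Fintype.card F = p ^ m)
    (h₃ : α₃ ≠ 0) : Function.Surjective (evalRoot (F := F) (3 * p ^ s) (unitBase α₁ α₃)) := by
  have hv : evalRoot (3 * p ^ s) (unitBase α₁ α₃)
      (C α₃⁻¹ * (X ^ 3 - C (alphaZero p m s α₁)) ^ p ^ s) = AdjoinRoot.of _ (vBase F) := by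
    rw [map_mul, map_pow, evalRoot_cubic, cubic_pow hp hm hF, unitBase_sub, evalRoot_C, ← map_mul,
      ← mul_assoc, ← map_mul, inv_mul_cancel₀ h₃, map_one, one_mul]
  intro y
  obtain ⟨q, rfl⟩ := AdjoinRoot.mk_surjective y
  rw [← RingHom.mem_range]
  induction q using Polynomial.induction_on' with
  | add q r hq hr => rw [map_add]; exact add_mem hq hr
  | monomial k a =>
    rw [← C_mul_X_pow_eq_monomial, map_mul, map_pow, AdjoinRoot.mk_X, AdjoinRoot.mk_C]
    refine mul_mem ?_ (pow_mem (RingHom.mem_range.mpr ⟨X, evalRoot_X _ _⟩) k)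
    rw [baseRing_eq a, map_add, map_mul]
    exact add_mem (RingHom.mem_range.mpr ⟨_, evalRoot_C _ _ _⟩)
      (mul_mem (RingHom.mem_range.mpr ⟨_, evalRoot_C _ _ _⟩) (RingHom.mem_range.mpr ⟨_, hv⟩))

theorem card_baseAmbient (hp : p.Prime) :
    Nat.card (Ambient (3 * p ^ s) (unitBase α₁ α₃)) = Nat.card F ^ (3 * (2 * p ^ s)) := by
  rw [card_ambient (by positivity [hp.pos])]
  have h : Nat.card (BaseRing F) = Nat.card F ^ 2 := by
    rw [sq, ← Nat.card_prod]
    rfl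
  rw [h, ← pow_mul]
  congr 1
  ring

/-- The induced map from F[x]/⟨f^(2p^s)⟩ is onto, and both sides have |F|^(6p^s) elements, so it is
injective. -/
theorem evalRoot_eq_zero_iff [Fintype F] (hp : p.Prime) (hm : 0 < m) (hF : Fintype.card F = p ^ m)
    (h₃ : α₃ ≠ 0) (P : F[X]) :
    evalRoot (3 * p ^ s) (unitBase α₁ α₃) P = 0 ↔
      (X ^ 3 - C (alphaZero p m s α₁)) ^ (2 * p ^ s) ∣ P := by
  set f : F[X] := X ^ 3 - C (alphaZero p m s α₁) with hf
  have h0 : evalRoot (3 * p ^ s) (unitBase α₁ α₃) (f ^ (2 * p ^ s)) = 0 := by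
    rw [map_pow, evalRoot_cubic, cubic_pow_two_mul hp hm hF (unitBase_sub_sq α₁ α₃)]
  have hle : ∀ a ∈ Ideal.span {f ^ (2 * p ^ s)},
      evalRoot (3 * p ^ s) (unitBase α₁ α₃) a = 0 := by
    intro a ha
    obtain ⟨c, rfl⟩ := Ideal.mem_span_singleton.mp ha
    rw [map_mul, h0, zero_mul]
  refine ⟨fun h => ?_, fun h => hle P (Ideal.mem_span_singleton.mpr h)⟩
  let φ := Ideal.Quotient.lift _ _ hle
  have hcard := card_quotient_span_monic (monic_cubic_pow (alphaZero p m s α₁) (2 * p ^ s))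
  rw [natDegree_cubic_pow] at hcard
  have hfin : Finite (F[X] ⧸ Ideal.span {f ^ (2 * p ^ s)}) :=
    Nat.finite_of_card_ne_zero (by rw [hcard]; exact pow_ne_zero _ Nat.card_pos.ne')
  have hbij : Function.Bijective φ := by
    refine (Nat.bijective_iff_surjective_and_card φ).mpr ⟨?_, ?_⟩
    · exact Ideal.Quotient.lift_surjective_of_surjective _ hle (evalRoot_surjective hp hm hF h₃)
    · rw [hcard, card_baseAmbient hp]
  have hP : φ (Ideal.Quotient.mk _ P) = φ 0 := by
    rw [map_zero, Ideal.Quotient.lift_mk, h]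
  exact Ideal.mem_span_singleton.mp (Ideal.Quotient.eq_zero_iff_mem.mp (hbij.1 hP))

/-- As l ≤ 2p^s, the kernel generator f^(2p^s) is a multiple of f^l, so membership pulls back to
divisibility in F[x]. -/
theorem evalRoot_mem_span_cubic_pow_iff [Fintype F] (hp : p.Prime) (hm : 0 < m)
    (hF : Fintype.card F = p ^ m) (h₃ : α₃ ≠ 0) {l : ℕ} (hl : l ≤ 2 * p ^ s) (P : F[X]) :
    evalRoot (3 * p ^ s) (unitBase α₁ α₃) P ∈
      Ideal.span {cubic (3 * p ^ s) (unitBase α₁ α₃) (alphaZero p m s α₁) ^ l} ↔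
      (X ^ 3 - C (alphaZero p m s α₁)) ^ l ∣ P := by
  rw [Ideal.mem_span_singleton, ← evalRoot_cubic, ← map_pow]
  refine ⟨?_, map_dvd _⟩
  rintro ⟨c, hc⟩
  obtain ⟨Q, rfl⟩ := evalRoot_surjective hp hm hF h₃ c
  rw [← map_mul, ← sub_eq_zero, ← map_sub, evalRoot_eq_zero_iff hp hm hF h₃] at hc
  exact (dvd_sub_left (dvd_mul_right _ Q)).mp ((pow_dvd_pow _ hl).trans hc)

/-- The quotient by this ideal is F[x]/⟨f^l⟩, of order |F|^(3l); dividing the order of the ring by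
it gives the count. -/
theorem card_span_cubic_pow [Fintype F] (hp : p.Prime) (hm : 0 < m) (hF : Fintype.card F = p ^ m)
    (h₃ : α₃ ≠ 0) {l : ℕ} (hl : l ≤ 2 * p ^ s) :
    Nat.card (Ideal.span {cubic (3 * p ^ s) (unitBase α₁ α₃) (alphaZero p m s α₁) ^ l}) =
      Nat.card F ^ (3 * (2 * p ^ s - l)) := by
  set J := Ideal.span {cubic (3 * p ^ s) (unitBase α₁ α₃) (alphaZero p m s α₁) ^ l}
  have hker : RingHom.ker ((Ideal.Quotient.mk J).comp (evalRoot (3 * p ^ s) (unitBase α₁ α₃))) =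
      Ideal.span {(X ^ 3 - C (alphaZero p m s α₁)) ^ l} := by
    ext P
    rw [RingHom.mem_ker, RingHom.comp_apply, Ideal.Quotient.eq_zero_iff_mem,
      evalRoot_mem_span_cubic_pow_iff hp hm hF h₃ hl, Ideal.mem_span_singleton]
  have hsurj : Function.Surjective
      ((Ideal.Quotient.mk J).comp (evalRoot (F := F) (3 * p ^ s) (unitBase α₁ α₃))) :=
    Ideal.Quotient.mk_surjective.comp (evalRoot_surjective hp hm hF h₃)
  have hq := Nat.card_congr (RingHom.quotientKerEquivOfSurjective hsurj).toEquiv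
  rw [hker, card_quotient_span_monic (monic_cubic_pow _ l), natDegree_cubic_pow] at hq
  have h := Submodule.card_eq_card_quotient_mul_card J
  rw [card_baseAmbient hp, ← hq] at h
  refine Nat.eq_of_mul_eq_mul_left (pow_pos (Nat.card_pos (α := F)) (3 * l)) ?_
  rw [← h.trans (mul_comm _ _), ← pow_add]
  congr 1
  omega

theorem mul_cubic_pow_eq_zero [Fintype F] (hp : p.Prime) (hm : 0 < m) (hF : Fintype.card F = p ^ m)
    (h₃ : α₃ ≠ 0) {l : ℕ} (hl : l ≤ 2 * p ^ s) {a : Ambient (3 * p ^ s) (unitBase α₁ α₃)}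
    (ha : a * cubic (3 * p ^ s) (unitBase α₁ α₃) (alphaZero p m s α₁) ^ l = 0) :
    cubic (3 * p ^ s) (unitBase α₁ α₃) (alphaZero p m s α₁) ^ (2 * p ^ s - l) ∣ a := by
  obtain ⟨P, rfl⟩ := evalRoot_surjective hp hm hF h₃ a
  rw [← evalRoot_cubic, ← map_pow, ← map_mul, evalRoot_eq_zero_iff hp hm hF h₃,
    ← Nat.sub_add_cancel hl, pow_add,
    mul_dvd_mul_iff_right (monic_cubic_pow _ l).ne_zero] at ha
  rw [← evalRoot_cubic, ← map_pow]
  simpa using map_dvd (evalRoot (3 * p ^ s) (unitBase α₁ α₃)) ha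

theorem cubic_pow_mem_span_iff [Fintype F] (hp : p.Prime) (hm : 0 < m) (hF : Fintype.card F = p ^ m)
    (h₃ : α₃ ≠ 0) {l : ℕ} (hl : l ≤ 2 * p ^ s) (k : ℕ) :
    cubic (3 * p ^ s) (unitBase α₁ α₃) (alphaZero p m s α₁) ^ k ∈
      Ideal.span {cubic (3 * p ^ s) (unitBase α₁ α₃) (alphaZero p m s α₁) ^ l} ↔ l ≤ k := by
  have h := evalRoot_mem_span_cubic_pow_iff (α₁ := α₁) hp hm hF h₃ hl
    ((X ^ 3 - C (alphaZero p m s α₁)) ^ k)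
  rw [map_pow, evalRoot_cubic] at h
  rw [h]
  -- Comparing exponents only needs f to be a nonzero nonunit, which its degree 3 shows.
  refine pow_dvd_pow_iff (monic_X_pow_sub_C _ three_ne_zero).ne_zero fun h => ?_
  have := natDegree_eq_zero_of_isUnit h
  rw [natDegree_X_pow_sub_C] at this
  omega

end ChainRing

/-! ### Residue, torsion and size of two-generator ideals -/

section Torsion

variable {p m s : ℕ} {α₁ α₃ α₄ : F}

theorem psi_cubic (n : ℕ) (a : F) :
    psi n α₁ α₃ α₄ (cubic n (unitElt α₁ α₃ α₄) a) = cubic n (unitBase α₁ α₃) a := by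
  have h : redCoeff F (algebraMap F _ a) = algebraMap F _ a := rfl
  rw [cubic, cubic, map_sub, map_pow, psi, AdjoinRoot.map_root, AdjoinRoot.map_of, h]

theorem Res_span_pair {n : ℕ} {a : F} (l t μ : ℕ)
    (z : Ambient n (unitElt α₁ α₃ α₄)) :
    Res (Ideal.span {cubic n (unitElt α₁ α₃ α₄) a ^ l +
        uClass n α₁ α₃ α₄ * cubic n (unitElt α₁ α₃ α₄) a ^ t * z,
        uClass n α₁ α₃ α₄ * cubic n (unitElt α₁ α₃ α₄) a ^ μ}) =
      Ideal.span {cubic n (unitBase α₁ α₃) a ^ l} := by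
  rw [Res_span, Set.image_pair]
  simp only [map_add, map_mul, map_pow, psi_uClass, psi_cubic, zero_mul, add_zero]
  rw [Ideal.span_insert, Ideal.span_singleton_zero, sup_bot_eq]

/-- Suppose uc = a(w^l + u w^t z) + b u w^μ. Modulo u this says that a kills w^l, so a = w^(2p^s-l)
d + ug. Substituting, the w^(2p^s) term vanishes, and modulo u the element c is a combination of
w^(2p^s-l+t) z, w^l and w^μ. The bounds on μ make each a multiple of w^μ. -/
theorem Tor_span_pair [Fintype F] (hp : p.Prime) (hm : 0 < m) (hF : Fintype.card F = p ^ m)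
    (h₃ : α₃ ≠ 0) {l t μ : ℕ} (hl : l ≤ 2 * p ^ s) (hμ : μ ≤ l)
    {z : Ambient (3 * p ^ s) (unitElt α₁ α₃ α₄)} (hz : z = 0 ∨ μ ≤ 2 * p ^ s + t - l)
    {w : Ambient (3 * p ^ s) (unitElt α₁ α₃ α₄)}
    (hw : w = cubic (3 * p ^ s) (unitElt α₁ α₃ α₄) (alphaZero p m s α₁))
    {e : Ambient (3 * p ^ s) (unitElt α₁ α₃ α₄)} (he : e = uClass (3 * p ^ s) α₁ α₃ α₄) :
    Tor (Ideal.span {w ^ l + e * w ^ t * z, e * w ^ μ}) =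
      Ideal.span {cubic (3 * p ^ s) (unitBase α₁ α₃) (alphaZero p m s α₁) ^ μ} := by
  have hpw : psi _ α₁ α₃ α₄ w =
      cubic (3 * p ^ s) (unitBase α₁ α₃) (alphaZero p m s α₁) := by rw [hw, psi_cubic]
  have hpe : psi _ α₁ α₃ α₄ e = 0 := by rw [he, psi_uClass]
  have hee : e * e = 0 := by rw [he, uClass_mul_self]
  have hw0 : w ^ (2 * p ^ s - l) * w ^ l = 0 := by
    rw [← pow_add, Nat.sub_add_cancel hl, hw, cubic_pow_two_mul hp hm hF (unitElt_sub_sq α₁ α₃ α₄)]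
  apply le_antisymm
  · intro c' hc'
    obtain ⟨c, rfl⟩ := psi_surjective _ α₁ α₃ α₄ c'
    rw [psi_mem_Tor, ← he, Ideal.mem_span_pair] at hc'
    obtain ⟨a, b, hab⟩ := hc'
    have ha := congrArg (psi _ α₁ α₃ α₄) hab
    simp only [map_add, map_mul, map_pow, hpe, hpw, zero_mul, mul_zero, add_zero] at ha
    obtain ⟨d', hd'⟩ := mul_cubic_pow_eq_zero hp hm hF h₃ hl ha
    obtain ⟨d, rfl⟩ := psi_surjective _ α₁ α₃ α₄ d'
    rw [← hpw, ← map_pow, ← map_mul, ← sub_eq_zero, ← map_sub] at hd'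
    obtain ⟨g, hg⟩ := exists_uClass_mul hd'
    rw [← he] at hg
    -- The multiple of u in the relation, with u factored out; cancelling u then determines c modulo
    -- u.
    have hkey : e * (c - (w ^ (2 * p ^ s - l) * w ^ t * (z * d) + w ^ l * g + w ^ μ * b)) = 0 := by
      linear_combination -hab + (w ^ l + e * w ^ t * z) * hg + g * w ^ t * z * hee + d * hw0
    rw [he] at hkey
    have hc := psi_eq_zero_of_uClass_mul (by have := hp.pos; positivity) hkey
    rw [map_sub, sub_eq_zero] at hc
    rw [hc, Ideal.mem_span_singleton]
    simp only [map_add, map_mul, map_pow, hpw]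
    refine dvd_add (dvd_add ?_ ?_) (dvd_mul_right _ _)
    · rcases hz with rfl | hz
      · simp
      · rw [← pow_add]
        exact (pow_dvd_pow _ (by omega)).mul_right _
    · exact (pow_dvd_pow _ hμ).mul_right _
  · rw [Ideal.span_singleton_le_iff_mem, ← hpw, ← map_pow, psi_mem_Tor, ← he]
    exact Ideal.subset_span (by simp)

theorem card_span_pair [Fintype F] (hp : p.Prime) (hm : 0 < m) (hF : Fintype.card F = p ^ m)
    (h₃ : α₃ ≠ 0) {l t μ : ℕ} (hl : l ≤ 2 * p ^ s) (hμ : μ ≤ l)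
    {z : Ambient (3 * p ^ s) (unitElt α₁ α₃ α₄)} (hz : z = 0 ∨ μ ≤ 2 * p ^ s + t - l)
    {w : Ambient (3 * p ^ s) (unitElt α₁ α₃ α₄)}
    (hw : w = cubic (3 * p ^ s) (unitElt α₁ α₃ α₄) (alphaZero p m s α₁))
    {e : Ambient (3 * p ^ s) (unitElt α₁ α₃ α₄)} (he : e = uClass (3 * p ^ s) α₁ α₃ α₄) :
    Nat.card (Ideal.span {w ^ l + e * w ^ t * z, e * w ^ μ}) =
      p ^ (3 * m * (4 * p ^ s - l - μ)) := by
  rw [card_eq_card_Res_mul_card_Tor (by have := hp.pos; positivity),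
    Tor_span_pair hp hm hF h₃ hl hμ hz hw he, hw, he, Res_span_pair l t μ,
    card_span_cubic_pow hp hm hF h₃ hl, card_span_cubic_pow hp hm hF h₃ (hμ.trans hl),
    Nat.card_eq_fintype_card, hF, ← pow_add, ← pow_mul, ← mul_add]
  have h : 2 * p ^ s - l + (2 * p ^ s - μ) = 4 * p ^ s - l - μ := by omega
  rw [h]
  congr 1
  ring

/-- Multiplying the generator by u gives u w^l. Multiplying it by w^(2p^s-l) kills the leading term
and leaves u w^(2p^s-l+t) z, where z can be inverted. -/
theorem span_singleton_eq_span_pair [Fintype F] (hp : p.Prime) (hm : 0 < m) (hF : Fintype.card F = p ^ m)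
    {l t μ : ℕ} (hl : l ≤ 2 * p ^ s)
    {z : Ambient (3 * p ^ s) (unitElt α₁ α₃ α₄)}
    (hμ : μ = l ∨ IsUnit z ∧ μ = 2 * p ^ s + t - l)
    {w : Ambient (3 * p ^ s) (unitElt α₁ α₃ α₄)}
    (hw : w = cubic (3 * p ^ s) (unitElt α₁ α₃ α₄) (alphaZero p m s α₁))
    {e : Ambient (3 * p ^ s) (unitElt α₁ α₃ α₄)} (he : e = uClass (3 * p ^ s) α₁ α₃ α₄) :
    Ideal.span {w ^ l + e * w ^ t * z} = Ideal.span {w ^ l + e * w ^ t * z, e * w ^ μ} := by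
  have hee : e * e = 0 := by rw [he, uClass_mul_self]
  have hw0 : w ^ (2 * p ^ s - l) * w ^ l = 0 := by
    rw [← pow_add, Nat.sub_add_cancel hl, hw, cubic_pow_two_mul hp hm hF (unitElt_sub_sq α₁ α₃ α₄)]
  rw [Ideal.span_insert, eq_comm, sup_eq_left, Ideal.span_singleton_le_iff_mem,
    Ideal.mem_span_singleton]
  rcases hμ with rfl | ⟨hz, rfl⟩
  · exact ⟨e, by linear_combination -w ^ t * z * hee⟩
  · obtain ⟨y, hy⟩ := hz.exists_right_inv
    refine ⟨w ^ (2 * p ^ s - l) * y, ?_⟩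
    have h : 2 * p ^ s + t - l = 2 * p ^ s - l + t := by omega
    rw [h, pow_add]
    linear_combination -y * hw0 - e * w ^ (2 * p ^ s - l) * w ^ t * hy

end Torsion

end Base

end Constacyclic

/-! ### The classification by types -/

theorem theorem8p3 (p m s : ℕ) (hp : p.Prime) (hp3 : p ≠ 3) (hm : 0 < m) (hs : 0 < s)
    {F : Type*} [Field F] [Fintype F] (hF : Fintype.card F = p ^ m)
    (α₁ α₃ α₄ : F) (h₁ : α₁ ≠ 0) (h₃ : α₃ ≠ 0) (h₄ : α₄ ≠ 0)
    (hcube : ¬ ∃ β : Constacyclic.CoeffRing F, β ^ 3 = Constacyclic.unitElt α₁ α₃ α₄)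
    (K : Constacyclic.Code (Constacyclic.CoeffRing F) (3 * p ^ s)
      (Constacyclic.unitElt α₁ α₃ α₄))
    -- the classes of `x³ - α₀` over `F + uF + vF + uvF` and over `F + vF`, and the class of `u`
    (w : Constacyclic.Ambient (3 * p ^ s) (Constacyclic.unitElt α₁ α₃ α₄))
    (hw : w = Constacyclic.cubic (3 * p ^ s) (Constacyclic.unitElt α₁ α₃ α₄)
      (Constacyclic.alphaZero p m s α₁))
    (w' : Constacyclic.Ambient (3 * p ^ s) (Constacyclic.unitBase α₁ α₃))
    (hw' : w' = Constacyclic.cubic (3 * p ^ s) (Constacyclic.unitBase α₁ α₃)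
      (Constacyclic.alphaZero p m s α₁))
    (u : Constacyclic.Ambient (3 * p ^ s) (Constacyclic.unitElt α₁ α₃ α₄))
    (hu : u = Constacyclic.uClass (3 * p ^ s) α₁ α₃ α₄) :
    -- Type A
    (K.toIdeal = Ideal.span {0} →
      Constacyclic.Res K.toIdeal = Ideal.span {0} ∧
      Constacyclic.Tor K.toIdeal = Ideal.span {0} ∧
      K.numWords = 1) ∧
    (K.toIdeal = Ideal.span {1} →
      Constacyclic.Res K.toIdeal = Ideal.span {1} ∧
      Constacyclic.Tor K.toIdeal = Ideal.span {1} ∧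
      K.numWords = p ^ (12 * m * p ^ s)) ∧
    -- Type B
    (∀ l : ℕ, l ≤ 2 * p ^ s - 1 → K.toIdeal = Ideal.span {u * w ^ l} →
      Constacyclic.Res K.toIdeal = Ideal.span {0} ∧
      Constacyclic.Tor K.toIdeal = Ideal.span {w' ^ l} ∧
      K.numWords = p ^ (3 * m * (2 * p ^ s - l))) ∧
    -- Type C with `z = 0`
    (∀ l : ℕ, 1 ≤ l → l ≤ 2 * p ^ s - 1 → K.toIdeal = Ideal.span {w ^ l} →
      Constacyclic.Res K.toIdeal = Ideal.span {w' ^ l} ∧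
      IsLeast {k : ℕ | u * w ^ k ∈ K.toIdeal} l ∧
      Constacyclic.Tor K.toIdeal = Ideal.span {w' ^ l} ∧
      K.numWords = p ^ (6 * m * (2 * p ^ s - l))) ∧
    -- Type C with `z` invertible
    (∀ (l t : ℕ) (z : Constacyclic.Ambient (3 * p ^ s) (Constacyclic.unitElt α₁ α₃ α₄)),
      1 ≤ l → l ≤ 2 * p ^ s - 1 → t < l → IsUnit z →
      K.toIdeal = Ideal.span {w ^ l + u * w ^ t * z} →
      Constacyclic.Res K.toIdeal = Ideal.span {w' ^ l} ∧
      IsLeast {k : ℕ | u * w ^ k ∈ K.toIdeal} (min l (2 * p ^ s + t - l)) ∧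
      Constacyclic.Tor K.toIdeal = Ideal.span {w' ^ min l (2 * p ^ s + t - l)} ∧
      ((l : ℚ) ≤ (p : ℚ) ^ s + (t : ℚ) / 2 →
        K.numWords = p ^ (6 * m * (2 * p ^ s - l))) ∧
      ((p : ℚ) ^ s + (t : ℚ) / 2 < (l : ℚ) →
        K.numWords = p ^ (3 * m * (2 * p ^ s - t)))) ∧
    -- Type D
    (∀ (l t μ : ℕ) (z : Constacyclic.Ambient (3 * p ^ s) (Constacyclic.unitElt α₁ α₃ α₄)),
      1 ≤ l → l ≤ 2 * p ^ s - 1 → t < l →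
      (z = 0 ∧ μ < l ∨ IsUnit z ∧ μ < min l (2 * p ^ s + t - l)) →
      K.toIdeal = Ideal.span {w ^ l + u * w ^ t * z, u * w ^ μ} →
      Constacyclic.Res K.toIdeal = Ideal.span {w' ^ l} ∧
      Constacyclic.Tor K.toIdeal = Ideal.span {w' ^ μ} ∧
      K.numWords = p ^ (3 * m * (4 * p ^ s - l - μ))) := by
  have hn : 3 * p ^ s ≠ 0 := by
    have := hp.pos
    positivity
  have hres : ∀ {l t μ : ℕ} {z}, Constacyclic.Res (Ideal.span {w ^ l + u * w ^ t * z, u * w ^ μ}) =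
      Ideal.span {w' ^ l} := by
    intro l t μ z
    rw [hw, hu, hw', Constacyclic.Res_span_pair]
  have htor : ∀ {l t μ : ℕ} {z}, l ≤ 2 * p ^ s → μ ≤ l → (z = 0 ∨ μ ≤ 2 * p ^ s + t - l) →
      Constacyclic.Tor (Ideal.span {w ^ l + u * w ^ t * z, u * w ^ μ}) =
        Ideal.span {w' ^ μ} := by
    intro l t μ z hl hμ hz
    rw [hw', Constacyclic.Tor_span_pair hp hm hF h₃ hl hμ hz hw hu]
  have hcard : ∀ {l t μ : ℕ} {z}, l ≤ 2 * p ^ s → μ ≤ l → (z = 0 ∨ μ ≤ 2 * p ^ s + t - l) →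
      K.toIdeal = Ideal.span {w ^ l + u * w ^ t * z, u * w ^ μ} →
      K.numWords = p ^ (3 * m * (4 * p ^ s - l - μ)) := by
    intro l t μ z hl hμ hz hK
    rw [K.numWords_eq_card hn, hK, Constacyclic.card_span_pair hp hm hF h₃ hl hμ hz hw hu]
  -- The condition u w^j ∈ C says that w'^j lies in Tor C = ⟨w'^k⟩, which for k ≤ 2p^s means k ≤ j.
  have hleast : ∀ {k : ℕ}, k ≤ 2 * p ^ s → Constacyclic.Tor K.toIdeal = Ideal.span {w' ^ k} →
      IsLeast {k : ℕ | u * w ^ k ∈ K.toIdeal} k := by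
    intro k hk hT
    have h : ∀ j, u * w ^ j ∈ K.toIdeal ↔ k ≤ j := by
      intro j
      rw [hu, ← Constacyclic.psi_mem_Tor, hT, map_pow, hw, Constacyclic.psi_cubic, hw',
        Constacyclic.cubic_pow_mem_span_iff hp hm hF h₃ hk]
    exact ⟨(h k).mpr le_rfl, fun j hj => (h j).mp hj⟩
  have hw0 : w ^ (2 * p ^ s) = 0 := by
    rw [hw, Constacyclic.cubic_pow_two_mul hp hm hF (Constacyclic.unitElt_sub_sq α₁ α₃ α₄)]
  have hw0' : w' ^ (2 * p ^ s) = 0 := by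
    rw [hw', Constacyclic.cubic_pow_two_mul hp hm hF (Constacyclic.unitBase_sub_sq α₁ α₃)]
  refine ⟨fun hK => ?_, fun hK => ?_, fun l hl hK => ?_, fun l hl₁ hl hK => ?_,
    fun l t z hl₁ hl ht hz hK => ?_, fun l t μ z hl₁ hl ht hz hK => ?_⟩
  -- The zero ideal is the case l = μ = 2p^s, where both powers vanish.
  · have hK' : K.toIdeal = Ideal.span {w ^ (2 * p ^ s) + u * w ^ 0 * 0, u * w ^ (2 * p ^ s)} := by
      simp [hK, hw0]
    refine ⟨?_, ?_, ?_⟩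
    · rw [hK', hres, hw0']
    · rw [hK', htor le_rfl le_rfl (Or.inl rfl), hw0']
    · have h : 4 * p ^ s - 2 * p ^ s - 2 * p ^ s = 0 := by omega
      rw [hcard le_rfl le_rfl (Or.inl rfl) hK', h, mul_zero, pow_zero]
  -- The unit ideal is the case l = μ = 0.
  · have hK' : K.toIdeal = Ideal.span {w ^ 0 + u * w ^ 0 * 0, u * w ^ 0} := by
      rw [hK, ← Constacyclic.span_singleton_eq_span_pair hp hm hF (Nat.zero_le _) (Or.inl rfl)
        hw hu]
      simp
    refine ⟨?_, ?_, ?_⟩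
    · rw [hK', hres, pow_zero]
    · rw [hK', htor (Nat.zero_le _) le_rfl (Or.inl rfl), pow_zero]
    · rw [hcard (Nat.zero_le _) le_rfl (Or.inl rfl) hK']
      congr 1
      simp only [Nat.sub_zero]
      ring
  · have hl' : l ≤ 2 * p ^ s := by omega
    -- Type B is the case l = 2p^s, z = 0: the first generator is zero.
    have hK' : K.toIdeal = Ideal.span {w ^ (2 * p ^ s) + u * w ^ 0 * 0, u * w ^ l} := by
      simp [hK, hw0]
    refine ⟨?_, ?_, ?_⟩
    · rw [hK', hres, hw0']
    · rw [hK', htor le_rfl hl' (Or.inl rfl)]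
    · have h : 4 * p ^ s - 2 * p ^ s - l = 2 * p ^ s - l := by omega
      rw [hcard le_rfl hl' (Or.inl rfl) hK', h]
  · have hl' : l ≤ 2 * p ^ s := by omega
    have hK' : K.toIdeal = Ideal.span {w ^ l + u * w ^ 0 * 0, u * w ^ l} := by
      rw [hK, ← Constacyclic.span_singleton_eq_span_pair hp hm hF hl' (Or.inl rfl) hw hu]
      simp
    have hT : Constacyclic.Tor K.toIdeal = Ideal.span {w' ^ l} := by
      rw [hK', htor hl' le_rfl (Or.inl rfl)]
    refine ⟨by rw [hK', hres], hleast hl' hT, hT, ?_⟩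
    have h : 4 * p ^ s - l - l = 2 * (2 * p ^ s - l) := by omega
    rw [hcard hl' le_rfl (Or.inl rfl) hK', h]
    congr 1
    ring
  · have hl' : l ≤ 2 * p ^ s := by omega
    have hle : min l (2 * p ^ s + t - l) ≤ l := min_le_left _ _
    have hle' : z = 0 ∨ min l (2 * p ^ s + t - l) ≤ 2 * p ^ s + t - l := Or.inr (min_le_right _ _)
    have hμ : min l (2 * p ^ s + t - l) = l ∨
        IsUnit z ∧ min l (2 * p ^ s + t - l) = 2 * p ^ s + t - l :=
      (min_choice _ _).imp_right fun h => ⟨hz, h⟩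
    have hK' := hK.trans
      (Constacyclic.span_singleton_eq_span_pair hp hm hF hl' hμ hw hu)
    have hT : Constacyclic.Tor K.toIdeal = Ideal.span {w' ^ min l (2 * p ^ s + t - l)} := by
      rw [hK', htor hl' hle hle']
    refine ⟨by rw [hK', hres], hleast (hle.trans hl') hT, hT, fun h => ?_, fun h => ?_⟩
    -- Doubling clears the fraction t/2. Here the minimum is l, so the exponent is 4p^s - 2l; in the
    -- other case it is 2p^s + t - l and l cancels.
    · have h2 : (2 * l : ℚ) ≤ 2 * p ^ s + t := by linarith
      have h3 : 2 * l ≤ 2 * p ^ s + t := by exact_mod_cast h2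
      have h4 : 4 * p ^ s - l - min l (2 * p ^ s + t - l) = 2 * (2 * p ^ s - l) := by omega
      rw [hcard hl' hle hle' hK', h4]
      congr 1
      ring
    · have h2 : (2 * p ^ s + t : ℚ) < 2 * l := by linarith
      have h3 : 2 * p ^ s + t < 2 * l := by exact_mod_cast h2
      have h4 : 4 * p ^ s - l - min l (2 * p ^ s + t - l) = 2 * p ^ s - t := by omega
      rw [hcard hl' hle hle' hK', h4]
  · have hl' : l ≤ 2 * p ^ s := by omega
    have hμ : μ ≤ l := by
      rcases hz with ⟨-, h⟩ | ⟨-, h⟩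
      · exact h.le
      · exact (h.trans_le (min_le_left _ _)).le
    have hle : z = 0 ∨ μ ≤ 2 * p ^ s + t - l :=
      hz.imp And.left fun h => (h.2.trans_le (min_le_right _ _)).le
    exact ⟨by rw [hK, hres], by rw [hK, htor hl' hμ hle], hcard hl' hμ hle hK⟩
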